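/- Let $(R,\mathfrak m,k)$ be a (Noetherian) Cohen--Macaulay local ring of Krull dimension $d$. All modules are finitely generated, and an $R$-module $M$ is called maximal Cohen--Macaulay if $M=0$ or $\operatorname{depth}M=d$. For an $R$-module $M$ let $\mu(M)$ be its minimal number of generators and let $$e(M)=\lim_{n\to\infty}\frac{d!}{n^d}\,\ell_R(M/\mathfrak m^nM)$$ be its multiplicity; $M$ is called Ulrich if $M$ is maximal Cohen--Macaulay and $e(M)=\mu(M)$. Suppose that $R$ has minimal multiplicity, that is, $e(R)=\operatorname{edim}R-\dim R+1$, where $\operatorname{edim}R=\mu(\mathfrak m)$. Let $M$ be a maximal Cohen--Macaulay $R$-module that is isomorphic to the kernel of an epimorphism from a free $R$-module to a maximal Cohen--Macaulay $R$-module, and suppose that $M$ has no nonzero free direct summand. Then $M$ is Ulrich. In other words, $\Omega\mathsf{CM}^\times(R)\subseteq\mathsf{Ul}(R)$, where $\Omega\mathsf{CM}^\times(R)$ denotes the class of modules $M$ as just described and $\mathsf{Ul}(R)$ the class of Ulrich $R$-modules. -/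

import Mathlib

open IsLocalRing Filter Topology

universe u v

/-- The Krull dimension of `R` as a natural number (for Noetherian local rings it is finite). -/
noncomputable def dimNat (R : Type u) [CommRing R] : ℕ :=
  ((ringKrullDim R).unbotD 0).toNat

theorem coe_dimNat (R : Type u) [CommRing R] [IsLocalRing R] [IsNoetherianRing R] :
    ((dimNat R : ℕ) : WithBot ℕ∞) = ringKrullDim R := by
  obtain ⟨m, hm⟩ := WithBot.ne_bot_iff_exists.mp (ringKrullDim_ne_bot (R := R))
  have htop : m ≠ ⊤ := by
    rintro rfl
    exact ringKrullDim_ne_top (R := R) hm.symm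
  obtain ⟨n, rfl⟩ := ENat.ne_top_iff_exists.mp htop
  rw [dimNat, ← hm]
  rfl

/-- `M` is a (maximal) Cohen--Macaulay module over the Noetherian local ring `R`: it is finitely
generated and the maximal ideal contains an `M`-sequence of length `dim R`. For `M ≠ 0`, Nakayama's
lemma makes a weakly regular sequence in the maximal ideal regular, so that this says
`depth M = dim R`; the zero module (of infinite depth) is included. -/
structure IsMaximalCM (R : Type u) [CommRing R] [IsLocalRing R]
    (M : Type v) [AddCommGroup M] [Module R M] : Prop where
  finite : Module.Finite R M
  exists_regular : ∃ rs : List R, rs.length = dimNat R ∧ (∀ r ∈ rs, r ∈ maximalIdeal R) ∧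
    RingTheory.Sequence.IsWeaklyRegular M rs

/-- `e(M) = e`, where the multiplicity of `M` is
`e(M) = lim_{n → ∞} d! ℓ(M / 𝔪ⁿ M) / n ^ d` with `d = dim R`. -/
def HasMultiplicity (R : Type u) [CommRing R] [IsLocalRing R]
    (M : Type v) [AddCommGroup M] [Module R M] (e : ℝ) : Prop :=
  Tendsto (fun n : ℕ =>
    ((dimNat R).factorial : ℝ) *
      ((Module.length R (M ⧸ (maximalIdeal R ^ n • (⊤ : Submodule R M)))).toNat : ℝ) /
        (n : ℝ) ^ dimNat R) atTop (𝓝 e)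

/-- The minimal number of generators `μ(M)`. -/
noncomputable def minGens (R : Type u) [CommRing R]
    (M : Type v) [AddCommGroup M] [Module R M] : ℕ :=
  (⊤ : Submodule R M).spanFinrank

/-- The embedding dimension of `R`, the minimal number of generators of the maximal ideal. -/
noncomputable def embDim (R : Type u) [CommRing R] [IsLocalRing R] : ℕ :=
  (maximalIdeal R).spanFinrank

/-- `R` has minimal multiplicity: `e(R) = edim R - dim R + 1`. -/
def HasMinimalMultiplicity (R : Type u) [CommRing R] [IsLocalRing R] : Prop :=
  HasMultiplicity R R ((embDim R : ℝ) - (dimNat R : ℝ) + 1)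

/-- `M` is an Ulrich module: it is maximal Cohen--Macaulay with `e(M) = μ(M)`. -/
structure IsUlrich (R : Type u) [CommRing R] [IsLocalRing R]
    (M : Type v) [AddCommGroup M] [Module R M] : Prop where
  isMaximalCM : IsMaximalCM R M
  multiplicity_eq : HasMultiplicity R M (minGens R M : ℝ)

/-- `M` is a maximal Cohen--Macaulay module which is (isomorphic to) the kernel of an epimorphism
from a finitely generated free module to a maximal Cohen--Macaulay module. -/
structure IsSyzygyOfCM (R : Type u) [CommRing R] [IsLocalRing R]
    (M : Type v) [AddCommGroup M] [Module R M] : Prop where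
  isMaximalCM : IsMaximalCM R M
  exists_epi : ∃ (n : ℕ) (N : Type u) (_ : AddCommGroup N) (_ : Module R N)
    (f : (Fin n → R) →ₗ[R] N),
    IsMaximalCM R N ∧ Function.Surjective f ∧ Nonempty (M ≃ₗ[R] LinearMap.ker f)

/-- `M` has no nonzero free direct summand. -/
def HasNoFreeSummand (R : Type u) [CommRing R]
    (M : Type v) [AddCommGroup M] [Module R M] : Prop :=
  ∀ F P : Submodule R M, IsCompl F P → Module.Free R F → F = ⊥

section Superficial

open Polynomial Pointwise

variable {R M : Type*} [CommRing R] [AddCommGroup M] [Module R M]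

/-- The filtration `i ↦ I ^ (i + 1) M`. -/
def Ideal.shiftedFiltration (I : Ideal R) (M : Type*) [AddCommGroup M] [Module R M] :
    I.Filtration M where
  N i := I ^ (i + 1) • ⊤
  mono i := Submodule.smul_mono_left (Ideal.pow_le_pow_right (by lia))
  smul_le i := by rw [← mul_smul, ← pow_succ']

/-- The Rees module `⨁ Iⁱ M` over the Rees algebra of `I`. -/
noncomputable abbrev Ideal.reesModule (I : Ideal R) (M : Type*) [AddCommGroup M] [Module R M] :
    Submodule (reesAlgebra I) (PolynomialModule R M) :=
  (I.stableFiltration (⊤ : Submodule R M)).submodule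

/-- The degree one part of the Rees algebra. -/
noncomputable def Ideal.reesDegreeOne (I : Ideal R) : I →ₗ[R] reesAlgebra I where
  toFun x := ⟨monomial 1 (x : R), reesAlgebra.monomial_mem.mpr (by simp)⟩
  map_add' x y := Subtype.ext (by simp)
  map_smul' r x := Subtype.ext (by simp [smul_monomial])

variable (I : Ideal R)

theorem Ideal.reesDegreeOne_smul_single (x : I) (j : ℕ) (a : M) :
    I.reesDegreeOne x • PolynomialModule.single R j a =
      PolynomialModule.single R (j + 1) ((x : R) • a) := by
  change (monomial 1 (x : R)) • PolynomialModule.single R j a = _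
  rw [PolynomialModule.monomial_smul_single, add_comm]

theorem Ideal.Filtration.single_mem_submodule_iff {I : Ideal R} (F : I.Filtration M) (j : ℕ)
    (a : M) : PolynomialModule.single R j a ∈ F.submodule ↔ a ∈ F.N j := by
  rw [Ideal.Filtration.mem_submodule]
  constructor
  · intro h
    simpa using h j
  · intro h i
    rw [PolynomialModule.coeff_single, Finsupp.single_apply]
    split_ifs with hij
    · subst hij; exact h
    · exact Submodule.zero_mem _

theorem Submodule.smul_mem_pow_succ_smul {T V : Type*} [CommRing T] [AddCommGroup V] [Module T V]
    {J : Ideal T} {W : Submodule T V} {j : ℕ} {y : T} {w : V} (hy : y ∈ J) (hw : w ∈ J ^ j • W) :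
    y • w ∈ J ^ (j + 1) • W := by
  rw [pow_succ', mul_smul]
  exact Submodule.smul_mem_smul hy hw

theorem Ideal.single_mem_pow_smul_reesModule (j : ℕ) (a : M)
    (ha : a ∈ I ^ j • (⊤ : Submodule R M)) :
    PolynomialModule.single R j a ∈
      Ideal.span (Set.range I.reesDegreeOne) ^ j • I.reesModule M := by
  induction j generalizing a with
  | zero =>
    rw [pow_zero, Submodule.one_smul, Ideal.reesModule,
      Ideal.Filtration.single_mem_submodule_iff]
    exact ha
  | succ j ih =>
    rw [pow_succ', mul_smul] at ha
    induction ha using Submodule.smul_induction_on' with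
    | smul x hx b hb =>
      rw [← I.reesDegreeOne_smul_single ⟨x, hx⟩ j b]
      exact Submodule.smul_mem_pow_succ_smul (Ideal.subset_span ⟨_, rfl⟩) (ih b hb)
    | add b hb c hc ihb ihc =>
      rw [PolynomialModule.single_add]
      exact add_mem ihb ihc

/-- If every associated prime of `K` contains `J`, then a power of `J` kills `K`. -/
theorem Ideal.exists_pow_le_annihilator_of_le_associatedPrimes {T K : Type*} [CommRing T]
    [IsNoetherianRing T] [AddCommGroup K] [Module T K] [Module.Finite T K] (J : Ideal T)
    (h : ∀ P ∈ associatedPrimes T K, J ≤ P) : ∃ c, J ^ c ≤ Module.annihilator T K := by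
  apply Ideal.exists_pow_le_of_le_radical_of_fg _ (IsNoetherian.noetherian J)
  rw [← Ideal.sInf_minimalPrimes]
  exact le_sInf fun P hP =>
    h P (Module.associatedPrimes.minimalPrimes_annihilator_subset_associatedPrimes T K hP)

/-- For a family of ring elements depending linearly on a parameter in `E`, the elements with
parameter outside finitely many proper submodules act injectively on the part of a finite module
that lies deep in the adic filtration defined by the whole family. -/
theorem Module.exists_finite_forall_smul_eq_zero_imp {T G E : Type*} [CommRing T]
    [IsNoetherianRing T] [AddCommGroup G] [Module T G] [Module.Finite T G] [Algebra R T]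
    [AddCommGroup E] [Module R E] (l : E →ₗ[R] T) :
    ∃ s : Set (Submodule R E), s.Finite ∧ (∀ V ∈ s, V ≠ ⊤) ∧
      ∀ x : E, (∀ V ∈ s, x ∉ V) → ∃ j₀, ∀ j ≥ j₀,
        ∀ g ∈ Ideal.span (Set.range l) ^ j • (⊤ : Submodule T G), l x • g = 0 → g = 0 := by
  let f : Ideal T → Submodule R E := fun P => (P.restrictScalars R).comap l
  refine ⟨f '' associatedPrimes T G \ {⊤},
    ((associatedPrimes.finite _ _).image f).sdiff, fun V hV => hV.2, fun x hx => ?_⟩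
  let J : Ideal T := Ideal.span (Set.range l)
  let K : Submodule T G := LinearMap.ker (LinearMap.lsmul T G (l x))
  have hKJ : ∀ P ∈ associatedPrimes T K, J ≤ P := by
    intro P hP
    have hP' : P ∈ associatedPrimes T G :=
      associatedPrimes.subset_of_injective (f := K.subtype) K.injective_subtype hP
    have hxP : x ∈ f P := by
      have : Module.annihilator T K ≤ P :=
        Submodule.annihilator_top.symm.trans_le hP.annihilator_le
      exact this (Module.mem_annihilator.mpr fun k => Subtype.ext k.2)
    have htop : f P = ⊤ := by
      by_contra hne
      exact hx _ ⟨⟨P, hP', rfl⟩, hne⟩ hxP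
    rw [Ideal.span_le]
    rintro _ ⟨y, rfl⟩
    exact (htop ▸ Submodule.mem_top : y ∈ f P)
  obtain ⟨c, hc⟩ := J.exists_pow_le_annihilator_of_le_associatedPrimes hKJ
  obtain ⟨k, hk⟩ := J.exists_pow_inf_eq_pow_smul K
  refine ⟨k + c, fun j hj g hg hxg => ?_⟩
  have hmem : g ∈ J ^ j • (⊤ : Submodule T G) ⊓ K := ⟨hg, hxg⟩
  rw [hk j (by lia)] at hmem
  have hle : J ^ (j - k) • (J ^ k • ⊤ ⊓ K) ≤ (⊥ : Submodule T G) := by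
    rw [Submodule.smul_le]
    intro r hr b hb
    have := hc (Ideal.pow_le_pow_right (by lia) hr)
    exact congrArg Subtype.val (Module.mem_annihilator.mp this ⟨b, hb.2⟩)
  exact hle hmem

theorem Submodule.exists_finite_forall_smul_mem_imp {T V E : Type*} [CommRing T]
    [IsNoetherianRing T] [AddCommGroup V] [Module T V] [Algebra R T]
    [AddCommGroup E] [Module R E] (l : E →ₗ[R] T) (W W₁ : Submodule T V) (hW : W.FG) :
    ∃ s : Set (Submodule R E), s.Finite ∧ (∀ V ∈ s, V ≠ ⊤) ∧
      ∀ x : E, (∀ V ∈ s, x ∉ V) → ∃ j₀, ∀ j ≥ j₀,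
        ∀ g ∈ Ideal.span (Set.range l) ^ j • W, l x • g ∈ W₁ → g ∈ W₁ := by
  have : Module.Finite T W := Module.Finite.iff_fg.mpr hW
  obtain ⟨s, hs, hne, h⟩ :=
    Module.exists_finite_forall_smul_eq_zero_imp (G := W ⧸ W₁.submoduleOf W) l
  refine ⟨s, hs, hne, fun x hx => ?_⟩
  obtain ⟨j₀, hj⟩ := h x hx
  refine ⟨j₀, fun j hjj g hg hxg => ?_⟩
  have hg' : g ∈ (Ideal.span (Set.range l) ^ j • (⊤ : Submodule T W)).map W.subtype := by
    rwa [Submodule.map_smul'', Submodule.map_top, Submodule.range_subtype]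
  obtain ⟨w, hw, rfl⟩ := hg'
  have := hj j hjj ((W₁.submoduleOf W).mkQ w) (by
    have := Submodule.mem_map_of_mem (f := (W₁.submoduleOf W).mkQ) hw
    rwa [Submodule.map_smul'', Submodule.map_top, Submodule.range_mkQ] at this) (by
    rw [← map_smul, Submodule.mkQ_apply, Submodule.Quotient.mk_eq_zero]
    exact hxg)
  rw [Submodule.mkQ_apply, Submodule.Quotient.mk_eq_zero] at this
  exact this

/-- An element of `I` outside finitely many proper submodules of `I` acts injectively on the
components of large degree of the graded module associated with `M`. -/
theorem Ideal.exists_finite_forall_superficial [IsNoetherianRing R] (M : Type*) [AddCommGroup M]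
    [Module R M] [Module.Finite R M] :
    ∃ s : Set (Submodule R I), s.Finite ∧ (∀ V ∈ s, V ≠ ⊤) ∧
      ∀ x : I, (∀ V ∈ s, x ∉ V) → ∃ j₀, ∀ j ≥ j₀, ∀ a ∈ I ^ j • (⊤ : Submodule R M),
        (x : R) • a ∈ I ^ (j + 2) • (⊤ : Submodule R M) →
          a ∈ I ^ (j + 1) • (⊤ : Submodule R M) := by
  obtain ⟨s, hs, hne, h⟩ := Submodule.exists_finite_forall_smul_mem_imp I.reesDegreeOne
    (I.reesModule M) (I.shiftedFiltration M).submodule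
    ((Ideal.Filtration.submodule_fg_iff_stable _ fun _ => IsNoetherian.noetherian _).mpr
      (I.stableFiltration_stable ⊤))
  refine ⟨s, hs, hne, fun x hx => ?_⟩
  obtain ⟨j₀, hj⟩ := h x hx
  refine ⟨j₀, fun j hjj a ha hxa => ?_⟩
  have := hj j hjj _ (I.single_mem_pow_smul_reesModule j a ha) (by
    rw [I.reesDegreeOne_smul_single]
    exact (Ideal.Filtration.single_mem_submodule_iff _ _ _).mpr hxa)
  exact (Ideal.Filtration.single_mem_submodule_iff _ _ _).mp this

/-- `x` is superficial on `M` with respect to `I`: `(Iⁿ⁺¹ M : x) = Iⁿ M` for large `n`. -/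
def Ideal.IsSuperficial (I : Ideal R) (M : Type*) [AddCommGroup M] [Module R M] (x : R) : Prop :=
  ∃ n₀, ∀ n ≥ n₀, ∀ a : M, x • a ∈ I ^ (n + 1) • (⊤ : Submodule R M) →
    a ∈ I ^ n • (⊤ : Submodule R M)

theorem Ideal.isSuperficial_of_isSMulRegular [IsNoetherianRing R] [Module.Finite R M] {x : R}
    (hx : IsSMulRegular M x)
    (h : ∃ j₀, ∀ j ≥ j₀, ∀ a ∈ I ^ j • (⊤ : Submodule R M),
      x • a ∈ I ^ (j + 2) • (⊤ : Submodule R M) → a ∈ I ^ (j + 1) • (⊤ : Submodule R M)) :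
    I.IsSuperficial M x := by
  obtain ⟨j₀, hj⟩ := h
  obtain ⟨k, hk⟩ := I.exists_pow_inf_eq_pow_smul (x • (⊤ : Submodule R M))
  refine ⟨j₀ + k, fun n hn a ha => ?_⟩
  have key : ∀ i, j₀ + i ≤ n → a ∈ I ^ (j₀ + i) • (⊤ : Submodule R M) := by
    intro i
    induction i with
    | zero =>
      intro _
      have hmem : x • a ∈ I ^ (n + 1) • (⊤ : Submodule R M) ⊓ x • (⊤ : Submodule R M) :=
        ⟨ha, Submodule.smul_mem_pointwise_smul a x ⊤ trivial⟩
      rw [hk _ (by lia)] at hmem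
      have hle : I ^ (n + 1 - k) • (I ^ k • ⊤ ⊓ x • (⊤ : Submodule R M)) ≤
          x • (I ^ j₀ • (⊤ : Submodule R M)) := by
        refine (Submodule.smul_mono (Ideal.pow_le_pow_right (by lia : j₀ ≤ n + 1 - k))
          inf_le_right).trans_eq ?_
        rw [← Submodule.ideal_span_singleton_smul, ← Submodule.ideal_span_singleton_smul,
          ← mul_smul, ← mul_smul, mul_comm]
      obtain ⟨b, hb, hab⟩ := hle hmem
      have : b = a := hx hab
      simpa [← this] using hb
    | succ i ih =>
      intro hi
      refine hj (j₀ + i) (by lia) a (ih (by lia)) ?_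
      exact Submodule.smul_mono_left (Ideal.pow_le_pow_right (by lia)) ha
  have := key (n - j₀) (by lia)
  rwa [show j₀ + (n - j₀) = n by lia] at this

end Superficial

section Avoidance

variable {R A : Type*} [CommRing R] [IsLocalRing R] [Infinite (ResidueField R)]
  [AddCommGroup A] [Module R A] [Module.Finite R A]

/-- A finitely generated module over a local ring with infinite residue field is not a finite union
of proper submodules. -/
theorem IsLocalRing.exists_forall_notMem_of_ne_top {s : Set (Submodule R A)} (hs : s.Finite)
    (h : ∀ V ∈ s, V ≠ ⊤) : ∃ a : A, ∀ V ∈ s, a ∉ V := by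
  by_contra! hcon
  obtain ⟨V, hV, hfin⟩ := Submodule.exists_finiteIndex_of_cover (s := hs.toFinset) (p := id)
    (Set.eq_univ_of_forall fun a => by simpa using hcon a)
  have hV := h V (by simpa using hV)
  have : V.toAddSubgroup.FiniteIndex := hfin
  have : Finite (A ⧸ V) := AddSubgroup.finite_quotient_of_finiteIndex
  have : Nontrivial (A ⧸ V) := Submodule.Quotient.nontrivial_iff.mpr hV
  obtain ⟨b, hb⟩ : ∃ b : A ⧸ V, b ∉ maximalIdeal R • (⊤ : Submodule R (A ⧸ V)) := by
    by_contra! hb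
    exact Submodule.top_ne_ideal_smul_of_le_jacobson_annihilator
      (maximalIdeal_le_jacobson (Module.annihilator R (A ⧸ V))) (eq_top_iff.mpr fun b _ => hb b).symm
  have : Function.Injective fun c : ResidueField R => Function.surjInv residue_surjective c • b := by
    intro c d hcd
    by_contra hne
    set r := Function.surjInv residue_surjective c with hr
    set t := Function.surjInv residue_surjective d with ht
    have hu : IsUnit (r - t) := by
      rw [← residue_ne_zero_iff_isUnit, map_sub, hr, ht,
        Function.surjInv_eq residue_surjective, Function.surjInv_eq residue_surjective]
      exact sub_ne_zero.mpr hne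
    have h0 : (r - t) • b = 0 := by rw [sub_smul, sub_eq_zero]; exact hcd
    rw [hu.smul_eq_zero] at h0
    exact hb (h0 ▸ Submodule.zero_mem _)
  have := Finite.of_injective _ this
  exact not_finite (ResidueField R)

end Avoidance

section SuperficialSequence

open RingTheory.Sequence

/-- `xs` is a sequence each of whose members is regular and superficial (with respect to `I`) on the
quotient of `A` by the preceding ones. -/
def Ideal.IsSuperficialSeq {R : Type u} [CommRing R] (I : Ideal R) :
    List R → ∀ (A : Type v) [AddCommGroup A] [Module R A], Prop
  | [], _, _, _ => True
  | x :: xs, A, _, _ =>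
    IsSMulRegular A x ∧ I.IsSuperficial A x ∧ I.IsSuperficialSeq xs (QuotSMulTop x A)

variable {R : Type u} [CommRing R]

theorem Ideal.IsSuperficialSeq.isWeaklyRegular {I : Ideal R} {xs : List R} {A : Type v}
    [AddCommGroup A] [Module R A] (h : I.IsSuperficialSeq xs A) : IsWeaklyRegular A xs := by
  induction xs generalizing A with
  | nil => simp
  | cons x xs ih => exact (isWeaklyRegular_cons_iff A x xs).mpr ⟨h.1, ih h.2.2⟩

variable [IsLocalRing R] [IsNoetherianRing R]

theorem IsLocalRing.exists_finite_forall_regular_superficial {A : Type v} [AddCommGroup A]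
    [Module R A] [Module.Finite R A] {d : ℕ}
    (h : ∃ rs : List R, rs.length = d + 1 ∧ (∀ r ∈ rs, r ∈ maximalIdeal R) ∧
      IsWeaklyRegular A rs) :
    ∃ s : Set (Submodule R (maximalIdeal R)), s.Finite ∧ (∀ V ∈ s, V ≠ ⊤) ∧
      ∀ x : maximalIdeal R, (∀ V ∈ s, x ∉ V) →
        IsSMulRegular A (x : R) ∧ (maximalIdeal R).IsSuperficial A (x : R) ∧
        ∃ rs : List R, rs.length = d ∧ (∀ r ∈ rs, r ∈ maximalIdeal R) ∧
          IsWeaklyRegular (QuotSMulTop (x : R) A) rs := by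
  obtain ⟨ys, hlen, hmem, hreg⟩ := h
  obtain ⟨rs, y, rfl⟩ : ∃ rs y, ys = rs ++ [y] := by
    rcases List.eq_nil_or_concat ys with rfl | ⟨rs, y, rfl⟩
    · simp at hlen
    · exact ⟨rs, y, by simp⟩
  have hy : y ∈ maximalIdeal R := hmem y (by simp)
  have hrs : ∀ r ∈ rs, r ∈ maximalIdeal R := fun r hr => hmem r (by simp [hr])
  rw [isWeaklyRegular_append_iff, isWeaklyRegular_singleton_iff] at hreg
  let B := A ⧸ (Ideal.ofList rs • ⊤ : Submodule R A)
  let f : Ideal R → Submodule R (maximalIdeal R) := fun P =>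
    Submodule.comap (Submodule.subtype (maximalIdeal R)) P
  have hB (x : R) : IsSMulRegular B x ↔ ∀ P ∈ associatedPrimes R B, x ∉ P := by
    have := biUnion_associatedPrimes_eq_compl_regular R (M := B)
    have hx := Set.ext_iff.mp this x
    simp only [Set.mem_iUnion, SetLike.mem_coe, exists_prop, Set.mem_compl_iff,
      Set.mem_ofPred_eq] at hx
    rw [← not_iff_not, ← hx]
    push Not
    rfl
  obtain ⟨s, hs, hne, h⟩ := (maximalIdeal R).exists_finite_forall_superficial A
  refine ⟨s ∪ f '' associatedPrimes R B, hs.union ((associatedPrimes.finite R B).image f), ?_, ?_⟩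
  · rintro V (hV | ⟨P, hP, rfl⟩)
    · exact hne V hV
    · intro htop
      have : (⟨y, hy⟩ : maximalIdeal R) ∈ f P := htop ▸ Submodule.mem_top
      exact (hB y).mp hreg.2 P hP this
  · intro x hx
    have hxB : IsSMulRegular B (x : R) :=
      (hB x).mpr fun P hP hxP => hx (f P) (Or.inr ⟨P, hP, rfl⟩) hxP
    have hperm : IsWeaklyRegular A ((x : R) :: rs) := by
      refine IsLocalRing.isWeaklyRegular_of_perm_of_subset_maximalIdeal
        (rs := rs ++ [(x : R)]) ?_ (List.perm_append_singleton _ _) ?_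
      · rw [isWeaklyRegular_append_iff, isWeaklyRegular_singleton_iff]
        exact ⟨hreg.1, hxB⟩
      · intro r hr
        rcases List.mem_append.mp hr with hr | hr
        · exact hrs r hr
        · rw [List.mem_singleton.mp hr]; exact x.2
    rw [isWeaklyRegular_cons_iff] at hperm
    exact ⟨hperm.1, Ideal.isSuperficial_of_isSMulRegular _ hperm.1
      (h x fun V hV => hx V (Or.inl hV)), rs, by simpa using hlen, hrs, hperm.2⟩

/-- Finitely many modules each having a regular sequence of length `d` have a common superficial
sequence of length `d`. -/
theorem IsLocalRing.exists_isSuperficialSeq [Infinite (ResidueField R)] {ι : Type*} [Finite ι]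
    (d : ℕ) (A : ι → Type v)
    [∀ i, AddCommGroup (A i)] [∀ i, Module R (A i)] [∀ i, Module.Finite R (A i)]
    (h : ∀ i, ∃ rs : List R, rs.length = d ∧ (∀ r ∈ rs, r ∈ maximalIdeal R) ∧
      IsWeaklyRegular (A i) rs) :
    ∃ xs : List R, xs.length = d ∧ (∀ x ∈ xs, x ∈ maximalIdeal R) ∧
      ∀ i, (maximalIdeal R).IsSuperficialSeq xs (A i) := by
  induction d generalizing A with
  | zero => exact ⟨[], rfl, by simp, fun _ => trivial⟩
  | succ d ih =>
    choose s hs hne hx using fun i => exists_finite_forall_regular_superficial (h i)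
    obtain ⟨x, hxs⟩ := exists_forall_notMem_of_ne_top (s := ⋃ i, s i) (Set.finite_iUnion hs)
      fun V hV => by
        obtain ⟨i, hi⟩ := Set.mem_iUnion.mp hV
        exact hne i V hi
    have hx' := fun i => hx i x fun V hV => hxs V (Set.mem_iUnion.mpr ⟨i, hV⟩)
    obtain ⟨xs, hlen, hmem, hsup⟩ := ih (fun i => QuotSMulTop (x : R) (A i)) fun i => (hx' i).2.2
    refine ⟨x :: xs, by simp [hlen], ?_, fun i => ⟨(hx' i).1, (hx' i).2.1, hsup i⟩⟩
    intro r hr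
    rcases List.mem_cons.mp hr with rfl | hr
    · exact x.2
    · exact hmem r hr

end SuperficialSequence

section Asymptotics

open Asymptotics

theorem isLittleO_pow_succ_of_eventually_sub_eq {u w : ℕ → ℝ} {d : ℕ}
    (h : ∀ᶠ n in atTop, u (n + 1) - u n = w (n + 1))
    (hw : w =o[atTop] fun n : ℕ => (n : ℝ) ^ d) :
    u =o[atTop] fun n : ℕ => (n : ℝ) ^ (d + 1) := by
  have h1 : (fun n => u (n + 1) - u n) =o[atTop] fun n : ℕ => ((n + 1 : ℕ) : ℝ) ^ d :=
    (hw.comp_tendsto (tendsto_add_atTop_nat 1)).congr' (h.mono fun n hn => hn.symm) .rfl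
  have h2 := h1.sum_range (fun n => by positivity) <| by
    refine tendsto_atTop_mono (fun n => ?_) tendsto_natCast_atTop_atTop
    calc (n : ℝ) = ∑ i ∈ Finset.range n, (1 : ℝ) := by simp
      _ ≤ _ := Finset.sum_le_sum fun i _ => one_le_pow₀ (by simp)
  simp_rw [Finset.sum_range_sub] at h2
  have h3 : (fun n => ∑ i ∈ Finset.range n, ((i + 1 : ℕ) : ℝ) ^ d) =O[atTop]
      fun n : ℕ => (n : ℝ) ^ (d + 1) := by
    refine IsBigO.of_bound 1 (Eventually.of_forall fun n => ?_)
    rw [Real.norm_of_nonneg (by positivity), Real.norm_of_nonneg (by positivity), one_mul, pow_succ']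
    calc ∑ i ∈ Finset.range n, ((i + 1 : ℕ) : ℝ) ^ d
        ≤ ∑ i ∈ Finset.range n, (n : ℝ) ^ d := Finset.sum_le_sum fun i hi => by
          have : i + 1 ≤ n := Finset.mem_range.mp hi
          gcongr
      _ = n * (n : ℝ) ^ d := by simp
  have h4 : (fun _ : ℕ => u 0) =o[atTop] fun n : ℕ => (n : ℝ) ^ (d + 1) := by
    refine isLittleO_const_left.mpr (Or.inr ?_)
    exact tendsto_norm_atTop_atTop.comp
      ((tendsto_pow_atTop (Nat.succ_ne_zero d)).comp tendsto_natCast_atTop_atTop)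
  simpa using (h2.trans_isBigO h3).add h4

theorem tendsto_factorial_mul_choose_div_pow (d : ℕ) :
    Tendsto (fun n : ℕ => (d.factorial : ℝ) * ((n + d).choose d : ℝ) / (n : ℝ) ^ d) atTop (𝓝 1) := by
  have h1 : Tendsto (fun n : ℕ => ((n + d : ℕ) : ℝ) / (n : ℝ)) atTop (𝓝 1) := by
    have : Tendsto (fun n : ℕ => (1 : ℝ) + d / (n : ℝ)) atTop (𝓝 (1 + 0)) :=
      tendsto_const_nhds.add (tendsto_const_div_atTop_nhds_zero_nat _)
    rw [add_zero] at this
    refine this.congr' ?_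
    filter_upwards [eventually_gt_atTop 0] with n hn
    push_cast
    field_simp
  have h2 := (isEquivalent_choose d).comp_tendsto (tendsto_add_atTop_nat d)
  have h3 := (isEquivalent_iff_tendsto_one (by
    filter_upwards [eventually_gt_atTop 0] with n hn
    have : 0 < n + d := by lia
    simp only [Function.comp]
    positivity)).mp h2
  have h4 := h3.mul (h1.pow d)
  rw [one_pow, one_mul] at h4
  refine h4.congr' ?_
  filter_upwards [eventually_gt_atTop 0] with n hn
  simp only [Pi.div_apply, Function.comp, div_pow]
  have : ((n + d : ℕ) : ℝ) ≠ 0 := by positivity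
  have : (n : ℝ) ≠ 0 := by positivity
  field_simp

theorem tendsto_factorial_mul_div_pow_of_isLittleO {h : ℕ → ℝ} {c : ℝ} {d : ℕ}
    (hh : (fun n => h n - c * ((n + d).choose d : ℝ)) =o[atTop] fun n : ℕ => (n : ℝ) ^ d) :
    Tendsto (fun n : ℕ => (d.factorial : ℝ) * h n / (n : ℝ) ^ d) atTop (𝓝 c) := by
  have := (hh.tendsto_div_nhds_zero.const_mul (d.factorial : ℝ)).add
    ((tendsto_factorial_mul_choose_div_pow d).const_mul c)
  rw [mul_zero, zero_add, mul_one] at this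
  refine this.congr fun n => ?_
  ring

end Asymptotics

section HilbertSamuel

open RingTheory.Sequence Asymptotics Pointwise

variable {R : Type u} [CommRing R]

theorem Module.length_quotient_pow_succ_eq_add (I : Ideal R) {A : Type v} [AddCommGroup A]
    [Module R A] {x : R} (hx : x ∈ I) {n : ℕ}
    (h : ∀ a : A, x • a ∈ I ^ (n + 1) • (⊤ : Submodule R A) → a ∈ I ^ n • (⊤ : Submodule R A)) :
    Module.length R (A ⧸ (I ^ (n + 1) • (⊤ : Submodule R A))) =
      Module.length R (A ⧸ (I ^ n • (⊤ : Submodule R A))) +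
        Module.length R (QuotSMulTop x A ⧸ (I ^ (n + 1) • (⊤ : Submodule R (QuotSMulTop x A)))) := by
  let f : (A ⧸ (I ^ n • (⊤ : Submodule R A))) →ₗ[R] A ⧸ (I ^ (n + 1) • (⊤ : Submodule R A)) :=
    Submodule.mapQ _ _ (LinearMap.lsmul R A x) fun a ha => Submodule.smul_mem_pow_succ_smul hx ha
  have hmap : (I ^ (n + 1) • (⊤ : Submodule R A)).map (x • (⊤ : Submodule R A)).mkQ =
      (I ^ (n + 1) • (⊤ : Submodule R (QuotSMulTop x A))) := by
    rw [Submodule.map_smul'', Submodule.map_top, Submodule.range_mkQ]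
  let g : (A ⧸ (I ^ (n + 1) • (⊤ : Submodule R A))) →ₗ[R]
      QuotSMulTop x A ⧸ (I ^ (n + 1) • (⊤ : Submodule R (QuotSMulTop x A))) :=
    Submodule.mapQ _ _ (x • (⊤ : Submodule R A)).mkQ (Submodule.map_le_iff_le_comap.mp hmap.le)
  have hf (a : A) : f (Submodule.Quotient.mk a) = Submodule.Quotient.mk (x • a) := rfl
  have hg (a : A) : g (Submodule.Quotient.mk a) =
    Submodule.Quotient.mk ((x • (⊤ : Submodule R A)).mkQ a) := rfl
  refine Module.length_eq_add_of_exact f g ?_ ?_ ?_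
  · rw [← LinearMap.ker_eq_bot, LinearMap.ker_eq_bot']
    intro a ha
    induction a using Submodule.Quotient.induction_on with | _ a
    rw [hf, Submodule.Quotient.mk_eq_zero] at ha
    exact (Submodule.Quotient.mk_eq_zero _).mpr (h a ha)
  · intro b
    induction b using Submodule.Quotient.induction_on with | _ b
    obtain ⟨a, rfl⟩ := Submodule.mkQ_surjective _ b
    exact ⟨Submodule.Quotient.mk a, rfl⟩
  · intro b
    induction b using Submodule.Quotient.induction_on with | _ b
    constructor
    · intro hb
      rw [hg, Submodule.Quotient.mk_eq_zero, ← hmap] at hb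
      obtain ⟨c, hc, hcb⟩ := hb
      have hsub : b - c ∈ x • (⊤ : Submodule R A) := by
        rw [← Submodule.Quotient.mk_eq_zero, Submodule.Quotient.mk_sub, sub_eq_zero]
        exact hcb.symm
      obtain ⟨a, -, ha⟩ := hsub
      refine ⟨Submodule.Quotient.mk a, ?_⟩
      rw [hf, Submodule.Quotient.eq]
      have : x • a = b - c := ha
      rw [this, sub_sub_cancel_left]
      exact neg_mem hc
    · rintro ⟨a, ha⟩
      induction a using Submodule.Quotient.induction_on with | _ a
      rw [← ha, hf, hg]
      have : (x • (⊤ : Submodule R A)).mkQ (x • a) = 0 := by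
        rw [Submodule.mkQ_apply, Submodule.Quotient.mk_eq_zero]
        exact Submodule.smul_mem_pointwise_smul a x ⊤ trivial
      rw [this, Submodule.Quotient.mk_zero]

theorem Module.length_quotient_smul_top_ne_top (I : Ideal R) [IsArtinianRing (R ⧸ I)]
    (A : Type v) [AddCommGroup A] [Module R A] [Module.Finite R A] :
    Module.length R (A ⧸ (I • (⊤ : Submodule R A))) ≠ ⊤ := by
  have : Module.Finite (R ⧸ I) (A ⧸ (I • (⊤ : Submodule R A))) :=
    Module.Finite.of_restrictScalars_finite R _ _
  rw [Module.length_eq_of_surjective (S := R) (R := R ⧸ I)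
    (M := A ⧸ (I • (⊤ : Submodule R A))) Ideal.Quotient.mk_surjective]
  exact Module.length_ne_top

variable [IsLocalRing R] [IsNoetherianRing R]

theorem IsLocalRing.length_quotient_pow_smul_top_ne_top (A : Type v) [AddCommGroup A] [Module R A]
    [Module.Finite R A] (n : ℕ) :
    Module.length R (A ⧸ (maximalIdeal R ^ n • (⊤ : Submodule R A))) ≠ ⊤ := by
  have : IsArtinianRing (R ⧸ maximalIdeal R ^ n) := by
    rcases Nat.eq_zero_or_pos n with rfl | hn
    · have : Subsingleton (R ⧸ maximalIdeal R ^ 0) := by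
        rw [pow_zero, Ideal.one_eq_top]
        infer_instance
      infer_instance
    · have : Nontrivial (R ⧸ maximalIdeal R ^ n) := Ideal.Quotient.nontrivial_iff.mpr
        ((Ideal.pow_le_self hn.ne').trans_lt (maximalIdeal.isMaximal R).ne_top.lt_top).ne
      have hsurj : Function.Surjective (Ideal.Quotient.mk (maximalIdeal R ^ n)) :=
        Ideal.Quotient.mk_surjective
      have : IsLocalRing (R ⧸ maximalIdeal R ^ n) := IsLocalRing.of_surjective' _ hsurj
      rw [isArtinianRing_iff_isNilpotent_maximalIdeal]
      refine ⟨n, ?_⟩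
      rw [← IsLocalRing.map_maximalIdeal_of_surjective _ hsurj, ← Ideal.map_pow,
        Ideal.map_quotient_self]
      rfl
  exact Module.length_quotient_smul_top_ne_top _ A

theorem IsLocalRing.exists_pow_smul_top_eq_bot {A : Type v} [AddCommGroup A] [Module R A]
    [Module.Finite R A] (h : Module.length R A ≠ ⊤) :
    ∃ n, maximalIdeal R ^ n • (⊤ : Submodule R A) = ⊥ := by
  have := (isFiniteLength_iff_isNoetherian_isArtinian.mp (Module.length_ne_top_iff.mp h)).2
  obtain ⟨n, hn⟩ := IsArtinian.monotone_stabilizes (R := R) (M := A)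
    ⟨fun n => OrderDual.toDual (maximalIdeal R ^ n • (⊤ : Submodule R A)),
      fun a b hab => Submodule.smul_mono_left (Ideal.pow_le_pow_right hab)⟩
  have h1 : maximalIdeal R ^ n • (⊤ : Submodule R A) =
    maximalIdeal R ^ (n + 1) • (⊤ : Submodule R A) := hn (n + 1) (by lia)
  refine ⟨n, Submodule.eq_bot_of_le_smul_of_le_jacobson_bot (maximalIdeal R) _
    (IsNoetherian.noetherian _) ?_ (maximalIdeal_le_jacobson _)⟩
  rw [← mul_smul, ← pow_succ']
  exact h1.le

/-- The Hilbert-Samuel function of a module with a superficial sequence of parameters. -/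
theorem Ideal.IsSuperficialSeq.isLittleO {xs : List R} (hxs : ∀ x ∈ xs, x ∈ maximalIdeal R)
    {A : Type v} [AddCommGroup A] [Module R A] [Module.Finite R A]
    (h : (maximalIdeal R).IsSuperficialSeq xs A)
    (hfin : Module.length R (A ⧸ (Ideal.ofList xs • (⊤ : Submodule R A))) ≠ ⊤) :
    (fun n : ℕ =>
      ((Module.length R (A ⧸ (maximalIdeal R ^ n • (⊤ : Submodule R A)))).toNat : ℝ) -
        ((Module.length R (A ⧸ (Ideal.ofList xs • (⊤ : Submodule R A)))).toNat : ℝ) *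
          ((n + xs.length).choose xs.length : ℝ)) =o[atTop] fun n : ℕ => (n : ℝ) ^ xs.length := by
  induction xs generalizing A with
  | nil =>
    have hbot : Ideal.ofList ([] : List R) • (⊤ : Submodule R A) = ⊥ := by simp
    have hA : Module.length R A ≠ ⊤ := by
      rwa [(Submodule.quotEquivOfEqBot _ hbot).length_eq] at hfin
    obtain ⟨n₀, hn₀⟩ := exists_pow_smul_top_eq_bot hA
    refine IsLittleO.congr' (isLittleO_zero _ _) ?_ .rfl
    filter_upwards [eventually_ge_atTop n₀] with n hn
    have hn' : maximalIdeal R ^ n • (⊤ : Submodule R A) = ⊥ :=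
      eq_bot_iff.mpr (hn₀ ▸ Submodule.smul_mono_left (Ideal.pow_le_pow_right hn))
    rw [(Submodule.quotEquivOfEqBot _ hbot).length_eq,
      (Submodule.quotEquivOfEqBot _ hn').length_eq]
    simp
  | cons x xs ih =>
    have e := (Submodule.quotOfListConsSMulTopEquivQuotSMulTopInner A x xs).length_eq
    rw [e] at hfin ⊢
    obtain ⟨-, ⟨n₀, hn₀⟩, hseq⟩ := h
    refine isLittleO_pow_succ_of_eventually_sub_eq ?_
      (ih (fun y hy => hxs y (List.mem_cons_of_mem _ hy)) hseq hfin)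
    filter_upwards [eventually_ge_atTop n₀] with n hn
    rw [Module.length_quotient_pow_succ_eq_add _ (hxs x List.mem_cons_self) (hn₀ n hn),
      ENat.toNat_add (length_quotient_pow_smul_top_ne_top _ _)
        (length_quotient_pow_smul_top_ne_top _ _), List.length_cons,
      show n + 1 + (xs.length + 1) = (n + 1 + xs.length) + 1 by lia, Nat.choose_succ_succ,
      show n + (xs.length + 1) = n + 1 + xs.length by lia]
    push_cast
    ring

theorem Ideal.IsSuperficialSeq.tendsto {xs : List R} (hxs : ∀ x ∈ xs, x ∈ maximalIdeal R)
    {A : Type v} [AddCommGroup A] [Module R A] [Module.Finite R A]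
    (h : (maximalIdeal R).IsSuperficialSeq xs A)
    (hfin : Module.length R (A ⧸ (Ideal.ofList xs • (⊤ : Submodule R A))) ≠ ⊤) :
    Tendsto (fun n : ℕ => (xs.length.factorial : ℝ) *
      ((Module.length R (A ⧸ (maximalIdeal R ^ n • (⊤ : Submodule R A)))).toNat : ℝ) /
        (n : ℝ) ^ xs.length) atTop
      (𝓝 ((Module.length R (A ⧸ (Ideal.ofList xs • (⊤ : Submodule R A)))).toNat : ℝ)) :=
  tendsto_factorial_mul_div_pow_of_isLittleO (h.isLittleO hxs hfin)

end HilbertSamuel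

section InfiniteResidueField

open RingTheory.Sequence

variable {R : Type u} [CommRing R]

theorem Submodule.length_quotient_eq_add_of_le {A : Type v} [AddCommGroup A] [Module R A]
    (P : Submodule R A) {Q : Submodule R A} {I : Ideal R} (hP : P = I • Q) :
    Module.length R (A ⧸ P) =
      Module.length R (Q ⧸ (I • (⊤ : Submodule R Q))) + Module.length R (A ⧸ Q) := by
  have hmap : (I • (⊤ : Submodule R Q)).map Q.subtype = P := by
    rw [hP, Submodule.map_smul'', Submodule.map_top, Submodule.range_subtype]
  have hcomap : I • (⊤ : Submodule R Q) = P.comap Q.subtype := by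
    rw [← hmap, Submodule.comap_map_eq_of_injective Q.injective_subtype]
  have hPQ : P ≤ Q := hP ▸ Submodule.smul_le_right
  let f : (Q ⧸ (I • (⊤ : Submodule R Q))) →ₗ[R] A ⧸ P := Submodule.mapQ _ _ Q.subtype hcomap.le
  have hf (q : Q) : f (Submodule.Quotient.mk q) = Submodule.Quotient.mk (q : A) := rfl
  refine Module.length_eq_add_of_exact f (Submodule.factor hPQ) ?_
    (Submodule.factor_surjective hPQ) ?_
  · rw [← LinearMap.ker_eq_bot, LinearMap.ker_eq_bot']
    intro q hq
    induction q using Submodule.Quotient.induction_on with | _ q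
    rw [hf, Submodule.Quotient.mk_eq_zero] at hq
    rw [Submodule.Quotient.mk_eq_zero, hcomap]
    exact hq
  · intro a
    induction a using Submodule.Quotient.induction_on with | _ a
    rw [← Submodule.mkQ_apply, Submodule.factor_mk, Submodule.mkQ_apply,
      Submodule.Quotient.mk_eq_zero]
    constructor
    · intro ha
      exact ⟨Submodule.Quotient.mk ⟨a, ha⟩, rfl⟩
    · rintro ⟨q, hq⟩
      induction q using Submodule.Quotient.induction_on with | _ q
      rw [hf, Submodule.mkQ_apply, Submodule.Quotient.eq] at hq
      have := Q.sub_mem q.2 (hPQ hq)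
      rwa [sub_sub_cancel] at this

theorem Submodule.eq_of_le_of_length_quotient_le {A : Type v} [AddCommGroup A] [Module R A]
    {P Q : Submodule R A} (hPQ : P ≤ Q) (hfin : Module.length R (A ⧸ Q) ≠ ⊤)
    (h : Module.length R (A ⧸ P) ≤ Module.length R (A ⧸ Q)) : P = Q := by
  have hsum := Module.length_eq_add_of_exact (LinearMap.ker (Submodule.factor hPQ)).subtype
    (Submodule.factor hPQ) (Submodule.injective_subtype _) (Submodule.factor_surjective hPQ)
    (LinearMap.exact_subtype_ker_map _)
  rw [hsum] at h
  have h0 : Module.length R (LinearMap.ker (Submodule.factor hPQ)) = 0 := by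
    have h' : Module.length R (LinearMap.ker (Submodule.factor hPQ)) + Module.length R (A ⧸ Q) ≤
      0 + Module.length R (A ⧸ Q) := by rwa [zero_add]
    exact le_bot_iff.mp ((ENat.add_le_add_iff_right hfin).mp h')
  rw [Module.length_eq_zero_iff, Submodule.subsingleton_iff_eq_bot] at h0
  refine le_antisymm hPQ fun a ha => ?_
  have : (Submodule.Quotient.mk a : A ⧸ P) ∈ LinearMap.ker (Submodule.factor hPQ) := by
    rw [LinearMap.mem_ker, ← Submodule.mkQ_apply, Submodule.factor_mk, Submodule.mkQ_apply,
      Submodule.Quotient.mk_eq_zero]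
    exact ha
  rw [h0, Submodule.mem_bot, Submodule.Quotient.mk_eq_zero] at this
  exact this

/-- If `0 → M → F → N → 0` is exact and `rs` is a weakly regular sequence on `N`, then
`M ∩ (rs) F = (rs) M`. -/
theorem RingTheory.Sequence.IsWeaklyRegular.comap_smul_top_le {M F N : Type*} [AddCommGroup M]
    [AddCommGroup F] [AddCommGroup N] [Module R M] [Module R F] [Module R N] {i : M →ₗ[R] F}
    {f : F →ₗ[R] N} (hi : Function.Injective i) (hif : Function.Exact i f)
    (hf : Function.Surjective f) {rs : List R} (h : IsWeaklyRegular N rs) :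
    (Ideal.ofList rs • (⊤ : Submodule R F)).comap i ≤ Ideal.ofList rs • (⊤ : Submodule R M) := by
  have hex : Function.Exact (0 : PUnit.{1} →ₗ[R] M) i := by
    rw [LinearMap.exact_zero_iff_injective]
    exact hi
  have := map_first_exact_on_four_term_right_exact_of_isSMulRegular_last hex hif hf h
  intro a ha
  obtain ⟨b, hb⟩ := (this (Submodule.Quotient.mk a)).mp (by
    rw [Submodule.mapQ_apply, Submodule.Quotient.mk_eq_zero]
    exact ha)
  induction b using Submodule.Quotient.induction_on with | _ b
  rw [Submodule.mapQ_apply, LinearMap.zero_apply, Submodule.Quotient.mk_zero] at hb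
  exact (Submodule.Quotient.mk_eq_zero _).mp hb.symm

variable [IsLocalRing R]

theorem IsLocalRing.length_quotient_maximalIdeal_smul_top {A : Type v} [AddCommGroup A]
    [Module R A] (Q : Submodule R A) (hQ : Q.FG) :
    Module.length R (Q ⧸ (maximalIdeal R • (⊤ : Submodule R Q))) = Q.spanFinrank := by
  let : Field (R ⧸ maximalIdeal R) := Ideal.Quotient.field _
  have : Module.Finite R Q := Module.Finite.iff_fg.mpr hQ
  have : Module.Finite (R ⧸ maximalIdeal R) (Q ⧸ (maximalIdeal R • (⊤ : Submodule R Q))) :=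
    Module.Finite.of_restrictScalars_finite R _ _
  rw [spanFinrank_eq_finrank_quotient Q hQ,
    Module.length_eq_of_surjective (S := R) (R := R ⧸ maximalIdeal R)
      (M := Q ⧸ (maximalIdeal R • (⊤ : Submodule R Q))) Ideal.Quotient.mk_surjective]
  exact Module.length_eq_finrank _ _

theorem IsLocalRing.length_quotient_pow_one_smul_top (A : Type v) [AddCommGroup A]
    [Module R A] [Module.Finite R A] :
    Module.length R (A ⧸ (maximalIdeal R ^ 1 • (⊤ : Submodule R A))) = minGens R A := by
  rw [minGens, ← length_quotient_maximalIdeal_smul_top _ Module.Finite.fg_top,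
    Submodule.length_quotient_eq_add_of_le (Q := ⊤) _ rfl, pow_one]
  have : Module.length R (A ⧸ (⊤ : Submodule R A)) = 0 := Module.length_eq_zero
  rw [this, add_zero]

variable [IsNoetherianRing R]

theorem IsLocalRing.isArtinianRing_quotient_ofList {xs : List R}
    (hxs : ∀ x ∈ xs, x ∈ maximalIdeal R) (hreg : IsWeaklyRegular R xs)
    (hdim : ringKrullDim R = xs.length) : IsArtinianRing (R ⧸ Ideal.ofList xs) := by
  have h := ringKrullDim_add_length_eq_ringKrullDim_of_isRegular xs
    (IsRegular.of_isWeaklyRegular_of_mem_maximalIdeal R hxs hreg)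
  rw [isArtinianRing_iff_krullDimLE_zero]
  rw [hdim] at h
  rw [Ring.krullDimLE_iff]
  exact (ENat.WithBot.add_le_add_natCast_right_iff (c := xs.length)).mp (by simpa using h.le)

theorem IsLocalRing.maximalIdeal_sq_le_of_length_add_eq {xs : List R}
    (hxs : ∀ x ∈ xs, x ∈ maximalIdeal R)
    (hlen : Module.length R (R ⧸ Ideal.ofList xs) + xs.length =
      Module.length R (R ⧸ maximalIdeal R ^ 2))
    (hfin : Module.length R (R ⧸ maximalIdeal R ^ 2) ≠ ⊤) :
    maximalIdeal R ^ 2 ≤ Ideal.ofList xs := by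
  have hgen : Submodule.spanFinrank (Ideal.ofList xs) ≤ xs.length := by
    classical
    have hset : {r | r ∈ xs} = (xs.toFinset : Set R) := by ext; simp
    have := Submodule.spanFinrank_span_le_ncard_of_finite (R := R) (s := {r | r ∈ xs})
      (List.finite_toSet xs)
    refine this.trans ?_
    rw [hset, Set.ncard_coe_finset]
    exact xs.toFinset_card_le
  have hle : maximalIdeal R * Ideal.ofList xs ≤ maximalIdeal R ^ 2 := by
    rw [sq]
    exact Ideal.mul_mono le_rfl (Ideal.span_le.mpr hxs)
  have hlen' : Module.length R (R ⧸ (maximalIdeal R * Ideal.ofList xs)) ≤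
      Module.length R (R ⧸ maximalIdeal R ^ 2) := by
    rw [Submodule.length_quotient_eq_add_of_le (maximalIdeal R * Ideal.ofList xs)
      (smul_eq_mul _ _).symm, length_quotient_maximalIdeal_smul_top _ (IsNoetherian.noetherian _),
      ← hlen, add_comm]
    gcongr
  have hEq : maximalIdeal R * Ideal.ofList xs = maximalIdeal R ^ 2 :=
    Submodule.eq_of_le_of_length_quotient_le hle hfin hlen'
  exact hEq.ge.trans (Ideal.mul_le.mpr fun _ _ _ hs => Ideal.mul_mem_left _ _ hs)

/-- A minimal multiplicity local ring with a superficial system of parameters generating `Q`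
satisfies `𝔪² ⊆ Q`. -/
theorem IsLocalRing.maximalIdeal_sq_le_of_isSuperficialSeq {xs : List R}
    (hxs : ∀ x ∈ xs, x ∈ maximalIdeal R) (hsup : (maximalIdeal R).IsSuperficialSeq xs R)
    (hfin : Module.length R (R ⧸ (Ideal.ofList xs • (⊤ : Submodule R R))) ≠ ⊤)
    (hmin : Tendsto (fun n : ℕ => (xs.length.factorial : ℝ) *
      ((Module.length R (R ⧸ (maximalIdeal R ^ n • (⊤ : Submodule R R)))).toNat : ℝ) /
        (n : ℝ) ^ xs.length) atTop
      (𝓝 (((Module.length R (R ⧸ (maximalIdeal R ^ 2 • (⊤ : Submodule R R)))).toNat : ℝ) -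
        xs.length))) :
    maximalIdeal R ^ 2 ≤ Ideal.ofList xs := by
  have htop (I : Ideal R) :
      Module.length R (R ⧸ (I • (⊤ : Submodule R R))) = Module.length R (R ⧸ I) :=
    (Submodule.quotEquivOfEq _ _ (by simp)).length_eq
  have h2 := length_quotient_pow_smul_top_ne_top (R := R) R 2
  have heq := tendsto_nhds_unique (hsup.tendsto hxs hfin) hmin
  rw [eq_sub_iff_add_eq] at heq
  rw [htop] at hfin h2
  refine maximalIdeal_sq_le_of_length_add_eq hxs ?_ h2
  rw [htop, htop] at heq
  rw [← ENat.natCast_toNat hfin, ← ENat.natCast_toNat h2]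
  exact_mod_cast heq

/-- The multiplicity of a maximal Cohen-Macaulay syzygy `M ⊆ 𝔪 F`, when the residue field is
infinite. -/
theorem IsLocalRing.tendsto_length_of_le_maximalIdeal_smul [Infinite (ResidueField R)] {d : ℕ}
    (hdim : ringKrullDim R = d) {M N : Type u} {F : Type*} [AddCommGroup M] [AddCommGroup F]
    [AddCommGroup N] [Module R M] [Module R F] [Module R N] [Module.Finite R M]
    [Module.Finite R N] {i : M →ₗ[R] F} {f : F →ₗ[R] N} (hi : Function.Injective i)
    (hif : Function.Exact i f) (hf : Function.Surjective f)
    (him : LinearMap.range i ≤ maximalIdeal R • (⊤ : Submodule R F))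
    (hR : ∃ rs : List R, rs.length = d ∧ (∀ r ∈ rs, r ∈ maximalIdeal R) ∧ IsWeaklyRegular R rs)
    (hM : ∃ rs : List R, rs.length = d ∧ (∀ r ∈ rs, r ∈ maximalIdeal R) ∧ IsWeaklyRegular M rs)
    (hN : ∃ rs : List R, rs.length = d ∧ (∀ r ∈ rs, r ∈ maximalIdeal R) ∧ IsWeaklyRegular N rs)
    (hmin : Tendsto (fun n : ℕ => (d.factorial : ℝ) *
      ((Module.length R (R ⧸ (maximalIdeal R ^ n • (⊤ : Submodule R R)))).toNat : ℝ) /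
        (n : ℝ) ^ d) atTop
      (𝓝 (((Module.length R (R ⧸ (maximalIdeal R ^ 2 • (⊤ : Submodule R R)))).toNat : ℝ) - d))) :
    Tendsto (fun n : ℕ => (d.factorial : ℝ) *
      ((Module.length R (M ⧸ (maximalIdeal R ^ n • (⊤ : Submodule R M)))).toNat : ℝ) /
        (n : ℝ) ^ d) atTop
      (𝓝 ((Module.length R (M ⧸ (maximalIdeal R ^ 1 • (⊤ : Submodule R M)))).toNat : ℝ)) := by
  let A : Fin 3 → ModuleCat.{u} R := ![ModuleCat.of R R, ModuleCat.of R M, ModuleCat.of R N]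
  have hA : ∀ j, Module.Finite R (A j) := by
    intro j
    fin_cases j
    · exact inferInstanceAs (Module.Finite R R)
    · exact inferInstanceAs (Module.Finite R M)
    · exact inferInstanceAs (Module.Finite R N)
  obtain ⟨xs, rfl, hmem, hsup⟩ := exists_isSuperficialSeq d (fun j => A j) (fun j => by
    fin_cases j
    · exact hR
    · exact hM
    · exact hN)
  have hsR : (maximalIdeal R).IsSuperficialSeq xs R := hsup 0
  have hsM : (maximalIdeal R).IsSuperficialSeq xs M := hsup 1
  have hsN : (maximalIdeal R).IsSuperficialSeq xs N := hsup 2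
  have := isArtinianRing_quotient_ofList hmem hsR.isWeaklyRegular hdim
  have hsq := maximalIdeal_sq_le_of_isSuperficialSeq hmem hsR
    (Module.length_quotient_smul_top_ne_top _ _) hmin
  have key : Ideal.ofList xs • (⊤ : Submodule R M) = maximalIdeal R ^ 1 • (⊤ : Submodule R M) := by
    rw [pow_one]
    refine le_antisymm (Submodule.smul_mono_left (Ideal.span_le.mpr hmem)) ?_
    refine le_trans ?_ (hsN.isWeaklyRegular.comap_smul_top_le hi hif hf)
    rw [← Submodule.map_le_iff_le_comap, Submodule.map_smul'', Submodule.map_top]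
    calc maximalIdeal R • LinearMap.range i
        ≤ maximalIdeal R • (maximalIdeal R • (⊤ : Submodule R F)) := smul_mono_right _ him
      _ = maximalIdeal R ^ 2 • (⊤ : Submodule R F) := by rw [← mul_smul, sq]
      _ ≤ _ := Submodule.smul_mono_left hsq
  have hlim := hsM.tendsto hmem (Module.length_quotient_smul_top_ne_top _ _)
  rwa [key] at hlim

end InfiniteResidueField

section BaseChange

open RingTheory.Sequence TensorProduct

theorem LinearEquiv.length_quotient_smul_top_eq {R : Type*} [CommRing R] (I : Ideal R)
    {A B : Type*} [AddCommGroup A] [AddCommGroup B] [Module R A] [Module R B] (e : A ≃ₗ[R] B) :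
    Module.length R (A ⧸ (I • (⊤ : Submodule R A))) =
      Module.length R (B ⧸ (I • (⊤ : Submodule R B))) :=
  (Submodule.Quotient.equiv _ _ e (by
    rw [Submodule.map_smul'', Submodule.map_top, LinearEquiv.range])).length_eq

/-- The local ring `R[X]` localized at `𝔪 R[X]` is a flat extension of `R` with infinite residue
field, having the same dimension and with maximal ideal generated by `𝔪`. -/
theorem IsLocalRing.exists_flat_infinite_residueField (R : Type u) [CommRing R] [IsLocalRing R]
    [IsNoetherianRing R] :
    ∃ (S : Type u) (_ : CommRing S) (_ : IsLocalRing S) (_ : Algebra R S), IsNoetherianRing S ∧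
      Module.Flat R S ∧ IsLocalHom (algebraMap R S) ∧
      (maximalIdeal R).map (algebraMap R S) = maximalIdeal S ∧
      Infinite (ResidueField S) ∧ ringKrullDim S = ringKrullDim R := by
  let P : Ideal (Polynomial R) := (maximalIdeal R).map Polynomial.C
  have hP : P.IsPrime := Ideal.isPrime_map_C_of_isPrime
  let S := Localization.AtPrime P
  have hmap : (maximalIdeal R).map (algebraMap R S) = maximalIdeal S := by
    rw [IsScalarTower.algebraMap_eq R (Polynomial R) S, ← Ideal.map_map]
    exact Localization.AtPrime.map_eq_maximalIdeal
  refine ⟨S, inferInstance, inferInstance, inferInstance,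
    IsLocalization.isNoetherianRing P.primeCompl S inferInstance, ?_, ?_, hmap, ?_, ?_⟩
  · have : Module.Flat (Polynomial R) S := IsLocalization.flat S P.primeCompl
    exact Module.Flat.trans R (Polynomial R) S
  · exact ((local_hom_TFAE (algebraMap R S)).out 0 2).mpr hmap.le
  · refine Infinite.of_injective
      (fun n : ℕ => residue S (algebraMap (Polynomial R) S (Polynomial.X ^ n))) fun a b hab => ?_
    by_contra hne
    have h0 : residue S (algebraMap (Polynomial R) S (Polynomial.X ^ a - Polynomial.X ^ b)) = 0 := by
      rw [map_sub, map_sub, sub_eq_zero]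
      exact hab
    rw [residue_eq_zero_iff, IsLocalization.AtPrime.to_map_mem_maximal_iff S P,
      Ideal.mem_map_C_iff] at h0
    have h1 := h0 a
    simp only [Polynomial.coeff_sub, Polynomial.coeff_X_pow, if_neg hne, if_true, sub_zero] at h1
    exact (maximalIdeal.isMaximal R).ne_top ((Ideal.eq_top_iff_one _).mpr h1)
  · rw [IsLocalization.AtPrime.ringKrullDim_eq_height P S, Polynomial.height_map_C,
      maximalIdeal_height_eq_ringKrullDim]

variable {R S : Type*} [CommRing R] [CommRing S] [Algebra R S]

theorem LinearMap.range_baseChange_le_map_smul_top {A B : Type*} [AddCommGroup A] [AddCommGroup B]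
    [Module R A] [Module R B] (I : Ideal R) {f : A →ₗ[R] B}
    (hf : LinearMap.range f ≤ I • (⊤ : Submodule R B)) :
    LinearMap.range (f.baseChange S) ≤ I.map (algebraMap R S) • (⊤ : Submodule S (S ⊗[R] B)) := by
  have key : ∀ b ∈ I • (⊤ : Submodule R B), ∀ s : S,
      s ⊗ₜ[R] b ∈ I.map (algebraMap R S) • (⊤ : Submodule S (S ⊗[R] B)) := by
    intro b hb s
    induction hb using Submodule.smul_induction_on' with
    | smul r hr b _ =>
      rw [← TensorProduct.smul_tmul, Algebra.smul_def, ← smul_eq_mul, ← TensorProduct.smul_tmul']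
      exact Submodule.smul_mem_smul (Ideal.mem_map_of_mem _ hr) trivial
    | add b _ c _ hb hc =>
      rw [TensorProduct.tmul_add]
      exact add_mem hb hc
  rintro _ ⟨t, rfl⟩
  induction t using TensorProduct.induction_on with
  | zero => simp
  | tmul s a => exact key _ (hf ⟨a, rfl⟩) s
  | add t t' ht ht' => rw [map_add]; exact add_mem ht ht'

theorem LinearMap.ker_baseChange_mkQ_smul_top (A : Type*) [AddCommGroup A] [Module R A]
    (I : Ideal R) :
    LinearMap.ker ((I • (⊤ : Submodule R A)).mkQ.baseChange S) =
      I.map (algebraMap R S) • (⊤ : Submodule S (S ⊗[R] A)) := by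
  apply le_antisymm
  · intro t ht
    have hex := lTensor_exact S (LinearMap.exact_subtype_mkQ (I • (⊤ : Submodule R A)))
      (Submodule.mkQ_surjective _)
    obtain ⟨t', rfl⟩ := (hex t).mp ht
    exact LinearMap.range_baseChange_le_map_smul_top (S := S) I
      (f := (I • (⊤ : Submodule R A)).subtype) (by rw [Submodule.range_subtype]) ⟨t', rfl⟩
  · rw [Submodule.smul_le]
    intro s hs t _
    induction hs using Submodule.span_induction with
    | mem s hs =>
      obtain ⟨r, hr, rfl⟩ := hs
      rw [LinearMap.mem_ker, map_smul]
      induction t using TensorProduct.induction_on with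
      | zero => simp
      | tmul s a =>
        rw [LinearMap.baseChange_tmul, algebraMap_smul, ← TensorProduct.tmul_smul, ← map_smul]
        have : (I • (⊤ : Submodule R A)).mkQ (r • a) = 0 := by
          rw [Submodule.mkQ_apply, Submodule.Quotient.mk_eq_zero]
          exact Submodule.smul_mem_smul hr trivial
        rw [this, TensorProduct.tmul_zero]
      | add t t' ht ht' => rw [map_add, smul_add, ht trivial, ht' trivial, add_zero]
    | zero => simp
    | add s s' _ _ hs hs' => rw [add_smul]; exact add_mem hs hs'
    | smul c s _ hs => rw [smul_assoc]; exact Submodule.smul_mem _ c hs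

theorem IsLocalRing.length_baseChange_quotient_pow_smul_top [IsLocalRing R] [IsLocalRing S]
    [Module.Flat R S] [IsLocalHom (algebraMap R S)]
    (hmap : (maximalIdeal R).map (algebraMap R S) = maximalIdeal S)
    (A : Type*) [AddCommGroup A] [Module R A] (n : ℕ) :
    Module.length S ((S ⊗[R] A) ⧸ (maximalIdeal S ^ n • (⊤ : Submodule S (S ⊗[R] A)))) =
      Module.length R (A ⧸ (maximalIdeal R ^ n • (⊤ : Submodule R A))) := by
  have h1 : Module.length S (S ⧸ (maximalIdeal R).map (algebraMap R S)) = 1 := by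
    rw [hmap, Module.length_eq_one_iff]
    exact isSimpleModule_iff_isCoatom.mpr (maximalIdeal.isMaximal S).out
  have h2 := IsLocalRing.length_baseChange R S (A ⧸ (maximalIdeal R ^ n • (⊤ : Submodule R A)))
  rw [h1, mul_one] at h2
  rw [← h2]
  have hker := LinearMap.ker_baseChange_mkQ_smul_top (S := S) A (maximalIdeal R ^ n)
  rw [Ideal.map_pow, hmap] at hker
  exact ((Submodule.quotEquivOfEq _ _ hker.symm).trans
    (LinearMap.quotKerEquivOfSurjective _
      (LinearMap.baseChange_surjective S (Submodule.mkQ_surjective _)))).length_eq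

end BaseChange

section NoFreeSummand

theorem HasNoFreeSummand.not_isUnit_apply {R : Type u} [CommRing R] {M : Type*} [AddCommGroup M]
    [Module R M] [Nontrivial R] (h : HasNoFreeSummand R M) (φ : M →ₗ[R] R) (m : M) :
    ¬ IsUnit (φ m) := by
  intro hu
  have hm (r : R) (hr : φ (r • m) = 0) : r = 0 := by
    rw [map_smul, smul_eq_mul] at hr
    exact (hu.mul_left_eq_zero).mp hr
  have hcompl : IsCompl (R ∙ m) (LinearMap.ker φ) := by
    constructor
    · rw [Submodule.disjoint_def]
      intro x hx hx'
      obtain ⟨r, rfl⟩ := Submodule.mem_span_singleton.mp hx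
      rw [hm r hx', zero_smul]
    · rw [codisjoint_iff, eq_top_iff]
      intro x _
      obtain ⟨w, hw⟩ := hu.exists_left_inv
      refine Submodule.mem_sup.mpr ⟨(φ x * w) • m, Submodule.smul_mem _ _
        (Submodule.mem_span_singleton_self m), x - (φ x * w) • m, ?_, by abel⟩
      rw [LinearMap.mem_ker, map_sub, map_smul, smul_eq_mul, mul_assoc, hw, mul_one, sub_self]
  have hfree : Module.Free R (R ∙ m) := by
    have hinj : Function.Injective (LinearMap.toSpanSingleton R M m) := by
      rw [← LinearMap.ker_eq_bot, LinearMap.ker_eq_bot']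
      intro r hr
      apply hm r
      rw [LinearMap.toSpanSingleton_apply] at hr
      rw [hr, map_zero]
    rw [← LinearMap.range_toSpanSingleton]
    exact Module.Free.of_equiv (LinearEquiv.ofInjective _ hinj)
  have h0 := h _ _ hcompl hfree
  rw [Submodule.span_singleton_eq_bot] at h0
  rw [h0, map_zero] at hu
  exact not_isUnit_zero hu

variable {R : Type u} [CommRing R] [IsLocalRing R]

theorem HasNoFreeSummand.range_le_maximalIdeal_smul_top {M : Type*} [AddCommGroup M] [Module R M]
    (h : HasNoFreeSummand R M) {n : ℕ} (i : M →ₗ[R] (Fin n → R)) :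
    LinearMap.range i ≤ maximalIdeal R • (⊤ : Submodule R (Fin n → R)) := by
  rintro _ ⟨m, rfl⟩
  rw [← Finset.univ_sum_single (i m)]
  refine Submodule.sum_mem _ fun j _ => ?_
  have hj : i m j ∈ maximalIdeal R := h.not_isUnit_apply ((LinearMap.proj j).comp i) m
  have : (Pi.single j (i m j) : Fin n → R) = i m j • Pi.single j (1 : R) := by
    rw [← Pi.single_smul, smul_eq_mul, mul_one]
  rw [this]
  exact Submodule.smul_mem_smul hj trivial

theorem IsLocalRing.length_quotient_maximalIdeal_sq [IsNoetherianRing R] :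
    Module.length R (R ⧸ (maximalIdeal R ^ 2 • (⊤ : Submodule R R))) = embDim R + 1 := by
  rw [Submodule.length_quotient_eq_add_of_le (Q := maximalIdeal R) (I := maximalIdeal R) _
    (by simp [sq]), length_quotient_maximalIdeal_smul_top _ (IsNoetherian.noetherian _), embDim]
  congr 1
  rw [Module.length_eq_one_iff]
  exact isSimpleModule_iff_isCoatom.mpr (maximalIdeal.isMaximal R).out

end NoFreeSummand

theorem proposition1p5 (R : Type u) [CommRing R] [IsLocalRing R] [IsNoetherianRing R]
    (hR : IsMaximalCM R R) (hmin : HasMinimalMultiplicity R)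
    (M : Type v) [AddCommGroup M] [Module R M]
    (hM : IsSyzygyOfCM R M) (hfree : HasNoFreeSummand R M) :
    IsUlrich R M := by
  refine ⟨hM.isMaximalCM, ?_⟩
  have := hM.isMaximalCM.finite
  obtain ⟨n, N, _, _, f, hN, hf, ⟨e⟩⟩ := hM.exists_epi
  have := hN.finite
  have him : LinearMap.range (LinearMap.ker f).subtype ≤
      maximalIdeal R • (⊤ : Submodule R (Fin n → R)) := by
    have := hfree.range_le_maximalIdeal_smul_top ((LinearMap.ker f).subtype.comp e.toLinearMap)
    rwa [LinearMap.range_comp, LinearEquiv.range, Submodule.map_top] at this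
  obtain ⟨S, _, _, _, _, _, _, hmap, _, hdim⟩ := exists_flat_infinite_residueField R
  have hlen (A : Type u) [AddCommGroup A] [Module R A] (n : ℕ) :=
    length_baseChange_quotient_pow_smul_top (S := S) hmap A n
  have hlenR (n : ℕ) : Module.length S (S ⧸ (maximalIdeal S ^ n • (⊤ : Submodule S S))) =
      Module.length R (R ⧸ (maximalIdeal R ^ n • (⊤ : Submodule R R))) := by
    rw [← hlen R n]
    exact (TensorProduct.AlgebraTensorModule.rid R S S).symm.length_quotient_smul_top_eq _
  have hreg {A B : Type u} [AddCommGroup A] [Module R A] [AddCommGroup B] [Module R B]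
      [Module S B] [IsScalarTower R S B] {g : A →ₗ[R] B} (hg : IsBaseChange S g)
      (h : ∃ rs : List R, rs.length = dimNat R ∧ (∀ r ∈ rs, r ∈ maximalIdeal R) ∧
        RingTheory.Sequence.IsWeaklyRegular A rs) :
      ∃ rs : List S, rs.length = dimNat R ∧ (∀ r ∈ rs, r ∈ maximalIdeal S) ∧
        RingTheory.Sequence.IsWeaklyRegular B rs := by
    obtain ⟨rs, hl, hm, hw⟩ := h
    refine ⟨rs.map (algebraMap R S), by simpa using hl, ?_, hw.of_flat_of_isBaseChange hg⟩
    intro s hs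
    obtain ⟨r, hr, rfl⟩ := List.mem_map.mp hs
    rw [← hmap]
    exact Ideal.mem_map_of_mem _ (hm r hr)
  have hK : ∃ rs : List R, rs.length = dimNat R ∧ (∀ r ∈ rs, r ∈ maximalIdeal R) ∧
      RingTheory.Sequence.IsWeaklyRegular (LinearMap.ker f) rs := by
    obtain ⟨rs, hl, hm, hw⟩ := hM.isMaximalCM.exists_regular
    exact ⟨rs, hl, hm, (e.isWeaklyRegular_congr rs).mp hw⟩
  have hrange := LinearMap.range_baseChange_le_map_smul_top (S := S) _ him
  rw [hmap] at hrange
  have hlim := tendsto_length_of_le_maximalIdeal_smul (R := S) (d := dimNat R)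
    (hdim.trans (coe_dimNat R).symm)
    (i := (LinearMap.ker f).subtype.baseChange S) (f := f.baseChange S)
    (Module.Flat.lTensor_preserves_injective_linearMap _ (Submodule.injective_subtype _))
    (lTensor_exact S (LinearMap.exact_subtype_ker_map f) hf)
    (LinearMap.baseChange_surjective S hf) hrange
    (hreg (IsBaseChange.linearMap R S) hR.exists_regular)
    (hreg (TensorProduct.isBaseChange R _ S) hK)
    (hreg (TensorProduct.isBaseChange R _ S) hN.exists_regular) (by
      simp only [hlenR]
      have hval : ((Module.length R (R ⧸ (maximalIdeal R ^ 2 • (⊤ : Submodule R R)))).toNat : ℝ) -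
          dimNat R = (embDim R : ℝ) - dimNat R + 1 := by
        rw [length_quotient_maximalIdeal_sq, ENat.toNat_add (by simp) (by simp), ENat.toNat_natCast,
          ENat.toNat_one]
        push_cast
        ring
      rw [hval]
      exact hmin)
  simp only [hlen, ← e.length_quotient_smul_top_eq] at hlim
  rw [length_quotient_pow_one_smul_top, ENat.toNat_natCast] at hlim
  exact hlim
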